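/- Consider classical two-sorted first-order logic with equality, with a sort of elements (variables $x, y, \dots$) and a sort $\mathsf{list}$ (variables $X, Y, \dots$), both interpreted by non-empty domains. Let $L_1$ be the language with the function symbols $\mathit{nil} : \mathsf{list}$, $\mathit{cons}$ (an element and a list to a list) and $\frown$ (two lists to a list), and no predicate symbols besides equality. Let $T_1$ be the theory axiomatized by the universal closures of $$\mathit{nil} \neq \mathit{cons}(x,X), \qquad \mathit{cons}(x,X) = \mathit{cons}(y,Y) \rightarrow x = y \wedge X = Y,$$ $$\mathit{nil} \frown Y = Y, \qquad \mathit{cons}(x,X) \frown Y = \mathit{cons}(x, X \frown Y).$$ Write $\mathit{cons}(x_1,\dots,x_k;X)$ for $\mathit{cons}(x_1, \mathit{cons}(x_2, \dots \mathit{cons}(x_k, X)\dots))$. For $m \geq 1$, quantifier-free $m$-step induction is the theory axiomatized by the universal closures of the formulas $$\Big( \bigwedge_{i=1}^{m} \forall x_1,\dots,x_{i-1}\, \varphi(\mathit{cons}(x_1,\dots,x_{i-1};\mathit{nil}),\vec z) \;\wedge\; \forall X\, \forall x_1,\dots,x_m \big(\varphi(X,\vec z) \rightarrow \varphi(\mathit{cons}(x_1,\dots,x_m;X),\vec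 z)\big)\Big) \rightarrow \forall X\, \varphi(X,\vec z),$$ where $\varphi(X,\vec z)$ ranges over the quantifier-free formulas of $L_1$ (the parameters $\vec z$ may have either sort). Let $T$ be the union of $T_1$ and of quantifier-free $m$-step induction for all $m \geq 1$. Then $T$ does not prove right decomposition, that is, the formula $$X = \mathit{nil} \;\vee\; \exists x'\, \exists X'.\; X = X' \frown \mathit{cons}(x',\mathit{nil}).$$ Moreover, the failure is witnessed by the sequence $N_0 = (0,1,2,\dots)$ of length $\omega$, in the following sense: there is a set $\mathfrak{L}$ of ordinal-indexed sequences of natural numbers that contains the empty sequence and $N_0$ and is closed under putting a natural number in front and under concatenation, such that the structure with elements $\mathbb{N}$ and lists $\mathfrak{L}$, in which $\mathit{nil}$ is the empty sequence, $\mathit{cons}(n,l) = (n) \frown l$ and $\frown$ is concatenation of sequences, is a model of $T$ in which right decomposition is false for $X = N_0$. -/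

import Mathlib

universe u

namespace ListInduction

/-! ### Two-sorted syntax: `nil`, `cons` and the concatenation symbol -/

/-- The two sorts: elements and lists. -/
inductive Srt : Type
  | elem : Srt
  | list : Srt

/-- Well-scoped variables (typed de Bruijn indices): `Var Γ s` is the type of the variables of
sort `s` in the finite list `Γ` of the sorts of the variables in scope, most recent first. -/
inductive Var : List Srt → Srt → Type
  | zero {Γ : List Srt} {s : Srt} : Var (s :: Γ) s
  | succ {Γ : List Srt} {s t : Srt} : Var Γ s → Var (t :: Γ) s

/-- Terms of the language with function symbols `nil : list`, `cons : elem × list → list` and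
`app : list × list → list` (concatenation). -/
inductive Term (Γ : List Srt) : Srt → Type
  | var {s : Srt} : Var Γ s → Term Γ s
  | nil : Term Γ Srt.list
  | cons : Term Γ Srt.elem → Term Γ Srt.list → Term Γ Srt.list
  | app : Term Γ Srt.list → Term Γ Srt.list → Term Γ Srt.list

/-- First-order formulas with equality in both sorts; there are no further predicate symbols.
The free variables of `φ : Fml Γ` are among those of `Γ`, so `Fml []` is the type of sentences. -/
inductive Fml : List Srt → Type
  | top {Γ : List Srt} : Fml Γ
  | bot {Γ : List Srt} : Fml Γ
  | eq {Γ : List Srt} {s : Srt} : Term Γ s → Term Γ s → Fml Γ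
  | neg {Γ : List Srt} : Fml Γ → Fml Γ
  | and {Γ : List Srt} : Fml Γ → Fml Γ → Fml Γ
  | or {Γ : List Srt} : Fml Γ → Fml Γ → Fml Γ
  | imp {Γ : List Srt} : Fml Γ → Fml Γ → Fml Γ
  | all {Γ : List Srt} (s : Srt) : Fml (s :: Γ) → Fml Γ
  | ex {Γ : List Srt} (s : Srt) : Fml (s :: Γ) → Fml Γ

/-- Simultaneous substitutions: terms over `Δ` for the variables of `Γ`. -/
abbrev Sub (Γ Δ : List Srt) : Type := ∀ ⦃s : Srt⦄, Var Γ s → Term Δ s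

/-- Substitution in a term. -/
def Term.subst {Γ Δ : List Srt} (σ : Sub Γ Δ) : {s : Srt} → Term Γ s → Term Δ s
  | _, .var v => σ v
  | _, .nil => .nil
  | _, .cons t u => .cons (t.subst σ) (u.subst σ)
  | _, .app t u => .app (t.subst σ) (u.subst σ)

/-- Regard a term over `Γ` as a term over `Γ` with one further variable. -/
def Term.weaken {Γ : List Srt} {s : Srt} (r : Srt) (t : Term Γ s) : Term (r :: Γ) s :=
  t.subst fun _ v => .var (.succ v)

/-- The substitution that sends the most recent variable to `t` and the others along `σ`. -/
def Sub.push {Γ Δ : List Srt} {r : Srt} (t : Term Δ r) (σ : Sub Γ Δ) : Sub (r :: Γ) Δ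
  | _, .zero => t
  | _, .succ v => σ v

/-- The substitution `σ` carried under a quantifier. -/
def Sub.lift {Γ Δ : List Srt} (r : Srt) (σ : Sub Γ Δ) : Sub (r :: Γ) (r :: Δ) :=
  Sub.push (.var .zero) fun _ v => (σ v).weaken r

/-- Capture-avoiding substitution in a formula. -/
def Fml.subst : {Γ Δ : List Srt} → Sub Γ Δ → Fml Γ → Fml Δ
  | _, _, _, .top => .top
  | _, _, _, .bot => .bot
  | _, _, σ, .eq t u => .eq (t.subst σ) (u.subst σ)
  | _, _, σ, .neg φ => .neg (φ.subst σ)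
  | _, _, σ, .and φ ψ => .and (φ.subst σ) (ψ.subst σ)
  | _, _, σ, .or φ ψ => .or (φ.subst σ) (ψ.subst σ)
  | _, _, σ, .imp φ ψ => .imp (φ.subst σ) (ψ.subst σ)
  | _, _, σ, .all s φ => .all s (φ.subst (σ.lift s))
  | _, _, σ, .ex s φ => .ex s (φ.subst (σ.lift s))

/-- Regard a formula over `Γ` as a formula over `Γ` with one further variable. -/
def Fml.weaken {Γ : List Srt} (r : Srt) (φ : Fml Γ) : Fml (r :: Γ) :=
  φ.subst fun _ v => .var (.succ v)

/-- `φ(t)`, for the most recent variable of `φ`. -/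
def Fml.inst {Γ : List Srt} {r : Srt} (φ : Fml (r :: Γ)) (t : Term Γ r) : Fml Γ :=
  φ.subst (Sub.push t fun _ v => .var v)

/-- Regard a sentence as a formula over `Γ`. -/
def Fml.ofSentence {Γ : List Srt} (φ : Fml []) : Fml Γ :=
  φ.subst fun _ (v : Var [] _) => nomatch v

/-- Universal closure. -/
def Fml.closure : {Γ : List Srt} → Fml Γ → Fml []
  | [], φ => φ
  | s :: _, φ => Fml.closure (.all s φ)

/-- Quantifier-free formulas. -/
def Fml.IsOpen : {Γ : List Srt} → Fml Γ → Prop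
  | _, .top => True
  | _, .bot => True
  | _, .eq _ _ => True
  | _, .neg φ => φ.IsOpen
  | _, .and φ ψ => φ.IsOpen ∧ ψ.IsOpen
  | _, .or φ ψ => φ.IsOpen ∧ ψ.IsOpen
  | _, .imp φ ψ => φ.IsOpen ∧ ψ.IsOpen
  | _, .all _ _ => False
  | _, .ex _ _ => False

/-- Conjunction of a finite list of formulas. -/
def Fml.conj {Γ : List Srt} (l : List (Fml Γ)) : Fml Γ := l.foldr .and .top

/-! ### Provability -/

/-- A theory is a set of sentences. -/
abbrev Theory : Type := Set (Fml [])

/-- Classical natural deduction for two-sorted first-order logic with equality. `Derives T A φ`: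
the formula `φ` is derivable from the axioms of `T` and the open assumptions `A`. The rule
`inhabited` expresses that both sorts are non-empty: formulas are well-scoped, so an unused
variable of a sort is not otherwise available. -/
inductive Derives (T : Theory) : {Γ : List Srt} → List (Fml Γ) → Fml Γ → Prop
  | ofTheory {Γ : List Srt} {A : List (Fml Γ)} {ψ : Fml []} :
      ψ ∈ T → Derives T A ψ.ofSentence
  | assumption {Γ : List Srt} {A : List (Fml Γ)} {φ : Fml Γ} : φ ∈ A → Derives T A φ
  | topI {Γ : List Srt} {A : List (Fml Γ)} : Derives T A .top
  | botE {Γ : List Srt} {A : List (Fml Γ)} {φ : Fml Γ} : Derives T A .bot → Derives T A φ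
  | negI {Γ : List Srt} {A : List (Fml Γ)} {φ : Fml Γ} :
      Derives T (φ :: A) .bot → Derives T A (.neg φ)
  | negE {Γ : List Srt} {A : List (Fml Γ)} {φ : Fml Γ} :
      Derives T A (.neg φ) → Derives T A φ → Derives T A .bot
  | byContra {Γ : List Srt} {A : List (Fml Γ)} {φ : Fml Γ} :
      Derives T (.neg φ :: A) .bot → Derives T A φ
  | andI {Γ : List Srt} {A : List (Fml Γ)} {φ ψ : Fml Γ} :
      Derives T A φ → Derives T A ψ → Derives T A (.and φ ψ)
  | andE₁ {Γ : List Srt} {A : List (Fml Γ)} {φ ψ : Fml Γ} :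
      Derives T A (.and φ ψ) → Derives T A φ
  | andE₂ {Γ : List Srt} {A : List (Fml Γ)} {φ ψ : Fml Γ} :
      Derives T A (.and φ ψ) → Derives T A ψ
  | orI₁ {Γ : List Srt} {A : List (Fml Γ)} {φ ψ : Fml Γ} :
      Derives T A φ → Derives T A (.or φ ψ)
  | orI₂ {Γ : List Srt} {A : List (Fml Γ)} {φ ψ : Fml Γ} :
      Derives T A ψ → Derives T A (.or φ ψ)
  | orE {Γ : List Srt} {A : List (Fml Γ)} {φ ψ χ : Fml Γ} :
      Derives T A (.or φ ψ) → Derives T (φ :: A) χ → Derives T (ψ :: A) χ → Derives T A χ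
  | impI {Γ : List Srt} {A : List (Fml Γ)} {φ ψ : Fml Γ} :
      Derives T (φ :: A) ψ → Derives T A (.imp φ ψ)
  | impE {Γ : List Srt} {A : List (Fml Γ)} {φ ψ : Fml Γ} :
      Derives T A (.imp φ ψ) → Derives T A φ → Derives T A ψ
  | allI {Γ : List Srt} {A : List (Fml Γ)} {s : Srt} {φ : Fml (s :: Γ)} :
      Derives T (A.map (Fml.weaken s)) φ → Derives T A (.all s φ)
  | allE {Γ : List Srt} {A : List (Fml Γ)} {s : Srt} {φ : Fml (s :: Γ)} (t : Term Γ s) :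
      Derives T A (.all s φ) → Derives T A (φ.inst t)
  | exI {Γ : List Srt} {A : List (Fml Γ)} {s : Srt} {φ : Fml (s :: Γ)} (t : Term Γ s) :
      Derives T A (φ.inst t) → Derives T A (.ex s φ)
  | exE {Γ : List Srt} {A : List (Fml Γ)} {s : Srt} {φ : Fml (s :: Γ)} {χ : Fml Γ} :
      Derives T A (.ex s φ) → Derives T (φ :: A.map (Fml.weaken s)) (χ.weaken s) →
      Derives T A χ
  | eqRefl {Γ : List Srt} {A : List (Fml Γ)} {s : Srt} (t : Term Γ s) : Derives T A (.eq t t)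
  | eqSubst {Γ : List Srt} {A : List (Fml Γ)} {s : Srt} (φ : Fml (s :: Γ)) {t u : Term Γ s} :
      Derives T A (.eq t u) → Derives T A (φ.inst t) → Derives T A (φ.inst u)
  | inhabited {Γ : List Srt} {A : List (Fml Γ)} (s : Srt) : Derives T A (.ex s .top)

/-- `T ⊢ φ`; the formula `φ` may have free variables. -/
def Provable (T : Theory) {Γ : List Srt} (φ : Fml Γ) : Prop := Derives T [] φ

/-! ### The theories -/

/-- `nil ≠ cons(x, X)`; the scope is `X, x`. -/
def nilNeCons : Fml [.list, .elem] :=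
  .neg (.eq .nil (.cons (.var (.succ .zero)) (.var .zero)))

/-- `cons(x, X) = cons(y, Y) → x = y ∧ X = Y`; the scope is `Y, y, X, x`. -/
def consInj : Fml [.list, .elem, .list, .elem] :=
  .imp
    (.eq (.cons (.var (.succ (.succ (.succ .zero)))) (.var (.succ (.succ .zero))))
      (.cons (.var (.succ .zero)) (.var .zero)))
    (.and (.eq (.var (.succ (.succ (.succ .zero)))) (.var (.succ .zero)))
      (.eq (.var (.succ (.succ .zero))) (.var .zero)))

/-- `nil ⌢ Y = Y`. -/
def nilApp : Fml [.list] := .eq (.app .nil (.var .zero)) (.var .zero)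

/-- `cons(x, X) ⌢ Y = cons(x, X ⌢ Y)`; the scope is `Y, X, x`. -/
def consApp : Fml [.list, .list, .elem] :=
  .eq
    (.app (.cons (.var (.succ (.succ .zero))) (.var (.succ .zero))) (.var .zero))
    (.cons (.var (.succ (.succ .zero))) (.app (.var (.succ .zero)) (.var .zero)))

/-- The base theory of the constructors. -/
def T₀ : Theory := {nilNeCons.closure, consInj.closure}

/-- The base theory of the constructors and of concatenation. -/
def T₁ : Theory := T₀ ∪ {nilApp.closure, consApp.closure}

/-- `cons(t₁, …, tₙ; T)`, that is `cons(t₁, cons(t₂, … cons(tₙ, T)))`. -/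
def consMult {Γ : List Srt} (ts : List (Term Γ .elem)) (T : Term Γ .list) : Term Γ .list :=
  ts.foldr .cons T

/-- The scope `Γ` extended by `k` element variables `x₁, …, xₖ` (with `xₖ` the most recent). -/
def elems : ℕ → List Srt → List Srt
  | 0, Γ => Γ
  | k + 1, Γ => .elem :: elems k Γ

/-- A variable of `Γ` as a variable of the extended scope. -/
def shift {Γ : List Srt} {s : Srt} : (k : ℕ) → Var Γ s → Var (elems k Γ) s
  | 0, v => v
  | k + 1, v => .succ (shift k v)

/-- The list `x₁, …, xₖ` of the new element variables. -/
def newVars {Γ : List Srt} : (k : ℕ) → List (Term (elems k Γ) .elem)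
  | 0 => []
  | k + 1 => (newVars k).map (Term.weaken .elem) ++ [.var .zero]

/-- `∀ x₁, …, xₖ. φ`. -/
def allElems {Γ : List Srt} : (k : ℕ) → Fml (elems k Γ) → Fml Γ
  | 0, φ => φ
  | k + 1, φ => allElems k (.all .elem φ)

/-- `∀ x₁, …, xₖ. φ(cons(x₁, …, xₖ; nil), z)`, for `φ = φ(X, z)` with `z` the variables
of `Γ`. -/
def indBase {Γ : List Srt} (k : ℕ) (φ : Fml (.list :: Γ)) : Fml Γ :=
  allElems k (φ.subst (Sub.push (consMult (newVars k) .nil) fun _ v => .var (shift k v)))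

/-- `∀ X, x₁, …, xₘ. φ(X, z) → φ(cons(x₁, …, xₘ; X), z)`. -/
def indStep {Γ : List Srt} (m : ℕ) (φ : Fml (.list :: Γ)) : Fml Γ :=
  .all .list (allElems m (.imp
    (φ.subst fun _ v => .var (shift m v))
    (φ.subst (Sub.push (consMult (newVars m) (.var (shift m .zero)))
      fun _ v => .var (shift m (.succ v))))))

/-- The `m`-step induction formula for `φ(X, z)`: its base cases are the lists of length
`0, …, m - 1`. -/
def bigStepInd {Γ : List Srt} (m : ℕ) (φ : Fml (.list :: Γ)) : Fml Γ :=
  .imp (.and (.conj ((List.range m).map fun k => indBase k φ)) (indStep m φ)) (.all .list φ)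

/-- Quantifier-free `m`-step induction. -/
def openBigStepInd (m : ℕ) : Theory :=
  {ψ | ∃ (Γ : List Srt) (φ : Fml (.list :: Γ)), φ.IsOpen ∧ ψ = (bigStepInd m φ).closure}

/-- `T₁` with quantifier-free `m`-step induction for all `m ≥ 1`. -/
def T₁OpenBigStep : Theory := T₁ ∪ ⋃ m : ℕ, ⋃ _ : 1 ≤ m, openBigStepInd m

/-- Right decomposition, `X = nil ∨ ∃ x' X'. X = X' ⌢ cons(x', nil)`, with free variable `X`. -/
def rightDecomposition : Fml [.list] :=
  .or (.eq (.var .zero) .nil)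
    (.ex .elem (.ex .list (.eq (.var (.succ (.succ .zero)))
      (.app (.var .zero) (.cons (.var (.succ .zero)) .nil)))))

/-! ### Structures and truth -/

/-- Two-sorted structures, with non-empty domains. -/
structure Struc : Type (u + 1) where
  dom : Srt → Type u
  dom_nonempty : ∀ s, Nonempty (dom s)
  nil : dom .list
  cons : dom .elem → dom .list → dom .list
  app : dom .list → dom .list → dom .list

/-- Assignments of values to the variables of `Γ`. -/
abbrev Assign (M : Struc.{u}) (Γ : List Srt) : Type u := ∀ ⦃s : Srt⦄, Var Γ s → M.dom s

/-- The assignment to no variables. -/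
def Assign.empty (M : Struc.{u}) : Assign M [] := fun _ v => nomatch v

/-- Extend an assignment by a value for one further variable. -/
def Assign.push {M : Struc.{u}} {Γ : List Srt} {r : Srt} (d : M.dom r) (ρ : Assign M Γ) :
    Assign M (r :: Γ)
  | _, .zero => d
  | _, .succ v => ρ v

/-- Value of a term. -/
def Struc.eval (M : Struc.{u}) {Γ : List Srt} (ρ : Assign M Γ) :
    {s : Srt} → Term Γ s → M.dom s
  | _, .var v => ρ v
  | _, .nil => M.nil
  | _, .cons t u => M.cons (M.eval ρ t) (M.eval ρ u)
  | _, .app t u => M.app (M.eval ρ t) (M.eval ρ u)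

/-- Truth of a formula under an assignment. -/
def Struc.Sat (M : Struc.{u}) : {Γ : List Srt} → Assign M Γ → Fml Γ → Prop
  | _, _, .top => True
  | _, _, .bot => False
  | _, ρ, .eq t u => M.eval ρ t = M.eval ρ u
  | _, ρ, .neg φ => ¬ M.Sat ρ φ
  | _, ρ, .and φ ψ => M.Sat ρ φ ∧ M.Sat ρ ψ
  | _, ρ, .or φ ψ => M.Sat ρ φ ∨ M.Sat ρ ψ
  | _, ρ, .imp φ ψ => M.Sat ρ φ → M.Sat ρ ψ
  | _, ρ, .all s φ => ∀ d : M.dom s, M.Sat (Assign.push d ρ) φ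
  | _, ρ, .ex s φ => ∃ d : M.dom s, M.Sat (Assign.push d ρ) φ

/-- `M` is a model of `T`. -/
def Struc.Models (M : Struc.{u}) (T : Theory) : Prop := ∀ ψ ∈ T, M.Sat (Assign.empty M) ψ

/-! ### Transfinite sequences of natural numbers -/

/-- A sequence of natural numbers indexed by the ordinals below its length. -/
structure TSeq : Type 1 where
  len : Ordinal.{0}
  val : Set.Iio len → ℕ

/-- The empty sequence. -/
def TSeq.empty : TSeq where
  len := 0
  val i := absurd i.2 (not_lt_zero (a := i.1))

/-- The one-element sequence `(n)`. -/
def TSeq.single (n : ℕ) : TSeq where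
  len := 1
  val _ := n

open Classical in
/-- Concatenation. For `γ ≥ a.len`, `γ - a.len` is the unique `δ` with `a.len + δ = γ`. -/
noncomputable def TSeq.concat (a b : TSeq) : TSeq where
  len := a.len + b.len
  val γ :=
    if h : γ.1 < a.len then a.val ⟨γ.1, h⟩
    else b.val ⟨γ.1 - a.len, (Ordinal.sub_lt_of_le (not_lt.mp h)).mpr γ.2⟩

/-- The sequence `N₀ = (0, 1, 2, …)` of length `ω`: the entry with index `n` is `n`. -/
noncomputable def TSeq.N₀ : TSeq where
  len := Ordinal.omega0
  val i := Classical.choose (Ordinal.lt_omega0.mp i.2)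

/-- A set of transfinite sequences that can serve as a domain of lists. -/
structure IsListDomain (D : Set TSeq) : Prop where
  empty_mem : TSeq.empty ∈ D
  cons_mem : ∀ (n : ℕ), ∀ a ∈ D, (TSeq.single n).concat a ∈ D
  concat_mem : ∀ a ∈ D, ∀ b ∈ D, a.concat b ∈ D

/-- The domains of `seqStruc`: the natural numbers and the sequences in `D`. -/
def seqDom (D : Set TSeq) : Srt → Type 1
  | .elem => ULift.{1} ℕ
  | .list => D

/-- The structure of the sequences in `D`: `nil` is the empty sequence, `cons` puts a number in
front of a sequence, and the concatenation symbol is concatenation. -/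
noncomputable def seqStruc (D : Set TSeq) (hD : IsListDomain D) : Struc.{1} where
  dom := seqDom D
  dom_nonempty
    | .elem => ⟨(ULift.up 0 : ULift.{1} ℕ)⟩
    | .list => ⟨(⟨TSeq.empty, hD.empty_mem⟩ : D)⟩
  nil := (⟨TSeq.empty, hD.empty_mem⟩ : D)
  cons := fun (n : ULift.{1} ℕ) (a : D) =>
    (⟨(TSeq.single n.down).concat a.1, hD.cons_mem n.down a.1 a.2⟩ : D)
  app := fun (a b : D) => (⟨a.1.concat b.1, hD.concat_mem a.1 a.2 b.1 b.2⟩ : D)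

end ListInduction

/-! The lists of the model are the sequences in which no number occurs at infinitely many finite
positions (`finRep`); entries at positions from `ω` on are unrestricted. `N₀` qualifies, and it has
no last entry because `ω` is not a successor, so right decomposition fails there. By soundness of
the calculus it remains to verify the axioms, and only induction needs an argument.

With the parameters fixed, a list term is a word in the unknown `X` and constant sequences.
Comparing two such words from the left, one cancels common prefixes until one side starts with `X`
and the other with a non-empty constant, or the outcome is settled outright. In the first case
equality fails as soon as the first entry of `X` differs from that of the constant. Hence each
quantifier-free formula has one truth value `p` on all sequences whose first entry avoids a finite
set `S` (`exists_finset_wordVal_eq_iff`, `exists_finset_sat_iff`).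

Let such a formula satisfy the premises of `m`-step induction. It holds at all finite lists by
ordinary induction. Since these include one-entry lists with entry outside `S`, `p` is true. An
infinite `X` in `finRep` takes values of `S` at only finitely many finite positions, so a prefix of
length a multiple of `m` can be removed to leave a sequence starting outside `S`. The formula holds
at that sequence, and the induction step, applied along the prefix, carries it to `X`
(`exists_fresh_suffix`, `finRep_induction`). -/

namespace ListInduction

/-! ### Soundness -/

section Semantics

variable {M : Struc.{u}}

@[simp] theorem Assign.push_zero {Γ : List Srt} {r : Srt} (d : M.dom r) (ρ : Assign M Γ) :
    Assign.push d ρ .zero = d := rfl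

@[simp] theorem Assign.push_succ {Γ : List Srt} {r s : Srt} (d : M.dom r) (ρ : Assign M Γ)
    (v : Var Γ s) : Assign.push d ρ (.succ v) = ρ v := rfl

/-- The assignment that gives each variable the value of the term substituted for it. -/
def Assign.comp {Γ Δ : List Srt} (ρ : Assign M Δ) (σ : Sub Γ Δ) : Assign M Γ :=
  fun _ v => M.eval ρ (σ v)

theorem Struc.eval_subst {Γ Δ : List Srt} (ρ : Assign M Δ) (σ : Sub Γ Δ) :
    ∀ {s : Srt} (t : Term Γ s), M.eval ρ (t.subst σ) = M.eval (ρ.comp σ) t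
  | _, .var _ => rfl
  | _, .nil => rfl
  | _, .cons t u => by simp only [Term.subst, Struc.eval, eval_subst ρ σ t, eval_subst ρ σ u]
  | _, .app t u => by simp only [Term.subst, Struc.eval, eval_subst ρ σ t, eval_subst ρ σ u]

theorem Struc.eval_weaken {Γ : List Srt} {r s : Srt} (d : M.dom r) (ρ : Assign M Γ)
    (t : Term Γ s) : M.eval (Assign.push d ρ) (t.weaken r) = M.eval ρ t :=
  M.eval_subst _ _ t

theorem Assign.comp_push {Γ Δ : List Srt} {r : Srt} (ρ : Assign M Δ) (t : Term Δ r)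
    (σ : Sub Γ Δ) : ρ.comp (Sub.push t σ) = Assign.push (M.eval ρ t) (ρ.comp σ) := by
  funext s v
  cases v <;> rfl

theorem Assign.comp_lift {Γ Δ : List Srt} {r : Srt} (ρ : Assign M Δ) (d : M.dom r)
    (σ : Sub Γ Δ) : (Assign.push d ρ).comp (σ.lift r) = Assign.push d (ρ.comp σ) := by
  funext s v
  cases v with
  | zero => rfl
  | succ v => exact M.eval_weaken d ρ (σ v)

theorem Struc.sat_subst {Γ Δ : List Srt} (σ : Sub Γ Δ) (φ : Fml Γ) (ρ : Assign M Δ) :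
    M.Sat ρ (φ.subst σ) ↔ M.Sat (ρ.comp σ) φ := by
  induction φ generalizing Δ with
  | top => rfl
  | bot => rfl
  | eq t u => simp only [Fml.subst, Struc.Sat, Struc.eval_subst]
  | neg φ ih => simp only [Fml.subst, Struc.Sat, ih]
  | and φ ψ ih₁ ih₂ => simp only [Fml.subst, Struc.Sat, ih₁, ih₂]
  | or φ ψ ih₁ ih₂ => simp only [Fml.subst, Struc.Sat, ih₁, ih₂]
  | imp φ ψ ih₁ ih₂ => simp only [Fml.subst, Struc.Sat, ih₁, ih₂]
  | all s φ ih => simp only [Fml.subst, Struc.Sat, ih, Assign.comp_lift]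
  | ex s φ ih => simp only [Fml.subst, Struc.Sat, ih, Assign.comp_lift]

theorem Struc.sat_weaken {Γ : List Srt} {r : Srt} (d : M.dom r) (ρ : Assign M Γ) (φ : Fml Γ) :
    M.Sat (Assign.push d ρ) (φ.weaken r) ↔ M.Sat ρ φ :=
  M.sat_subst _ φ _

theorem Struc.sat_inst {Γ : List Srt} {r : Srt} (ρ : Assign M Γ) (φ : Fml (r :: Γ))
    (t : Term Γ r) : M.Sat ρ (φ.inst t) ↔ M.Sat (Assign.push (M.eval ρ t) ρ) φ := by
  rw [Fml.inst, Struc.sat_subst, Assign.comp_push]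
  rfl

theorem Struc.sat_ofSentence {Γ : List Srt} (ρ : Assign M Γ) (φ : Fml []) :
    M.Sat ρ φ.ofSentence ↔ M.Sat (Assign.empty M) φ := by
  rw [Fml.ofSentence, Struc.sat_subst]
  have : ρ.comp (fun _ (v : Var [] _) => nomatch v) = Assign.empty M := by
    funext s v
    exact nomatch v
  rw [this]

theorem Struc.sat_map_weaken {Γ : List Srt} {r : Srt} {d : M.dom r} {ρ : Assign M Γ}
    {A : List (Fml Γ)} (h : ∀ ψ ∈ A, M.Sat ρ ψ) :
    ∀ ψ ∈ A.map (Fml.weaken r), M.Sat (Assign.push d ρ) ψ := by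
  intro ψ hψ
  obtain ⟨χ, hχ, rfl⟩ := List.mem_map.mp hψ
  exact (M.sat_weaken d ρ χ).mpr (h χ hχ)

/-- Soundness of natural deduction. -/
theorem Derives.sound {T : Theory} (hM : M.Models T) {Γ : List Srt} {A : List (Fml Γ)}
    {φ : Fml Γ} (h : Derives T A φ) (ρ : Assign M Γ) (hA : ∀ ψ ∈ A, M.Sat ρ ψ) :
    M.Sat ρ φ := by
  induction h with
  | ofTheory h => exact (M.sat_ofSentence ρ _).mpr (hM _ h)
  | assumption h => exact hA _ h
  | topI => trivial
  | botE _ ih => exact (ih ρ hA).elim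
  | negI _ ih => exact fun h => ih ρ (List.forall_mem_cons.mpr ⟨h, hA⟩)
  | negE _ _ ih₁ ih₂ => exact ih₁ ρ hA (ih₂ ρ hA)
  | byContra _ ih => exact by_contra fun h => ih ρ (List.forall_mem_cons.mpr ⟨h, hA⟩)
  | andI _ _ ih₁ ih₂ => exact ⟨ih₁ ρ hA, ih₂ ρ hA⟩
  | andE₁ _ ih => exact (ih ρ hA).1
  | andE₂ _ ih => exact (ih ρ hA).2
  | orI₁ _ ih => exact Or.inl (ih ρ hA)
  | orI₂ _ ih => exact Or.inr (ih ρ hA)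
  | orE _ _ _ ih ih₁ ih₂ =>
    exact (ih ρ hA).elim (fun h => ih₁ ρ (List.forall_mem_cons.mpr ⟨h, hA⟩))
      fun h => ih₂ ρ (List.forall_mem_cons.mpr ⟨h, hA⟩)
  | impI _ ih => exact fun h => ih ρ (List.forall_mem_cons.mpr ⟨h, hA⟩)
  | impE _ _ ih₁ ih₂ => exact ih₁ ρ hA (ih₂ ρ hA)
  | allI _ ih => exact fun d => ih _ (M.sat_map_weaken hA)
  | allE t _ ih => exact (M.sat_inst ρ _ t).mpr (ih ρ hA _)
  | exI t _ ih => exact ⟨_, (M.sat_inst ρ _ t).mp (ih ρ hA)⟩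
  | exE _ _ ih₁ ih₂ =>
    obtain ⟨d, hd⟩ := ih₁ ρ hA
    exact (M.sat_weaken d ρ _).mp (ih₂ _ (List.forall_mem_cons.mpr ⟨hd, M.sat_map_weaken hA⟩))
  | eqRefl t => rfl
  | eqSubst φ _ _ ih₁ ih₂ =>
    have h₁ := ih₁ ρ hA
    have h₂ := ih₂ ρ hA
    rw [M.sat_inst] at h₂ ⊢
    rwa [← show M.eval ρ _ = M.eval ρ _ from h₁]
  | inhabited s => exact ⟨(M.dom_nonempty s).some, trivial⟩

/-! ### Truth of the induction formulas -/

theorem Struc.sat_closure_iff :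
    ∀ {Γ : List Srt} (φ : Fml Γ), M.Sat (Assign.empty M) φ.closure ↔ ∀ ρ : Assign M Γ, M.Sat ρ φ
  | [], φ => by
    refine ⟨fun h ρ => ?_, fun h => h _⟩
    have : ρ = Assign.empty M := by
      funext s v
      exact nomatch v
    rwa [this]
  | s :: Γ, φ => by
    rw [Fml.closure, sat_closure_iff (.all s φ)]
    refine ⟨fun h ρ => ?_, fun h ρ d => h _⟩
    have : ρ = Assign.push (ρ .zero) (fun _ v => ρ (.succ v)) := by
      funext s v
      cases v <;> rfl
    rw [this]
    exact h _ _

theorem Struc.sat_conj_iff {Γ : List Srt} (ρ : Assign M Γ) (l : List (Fml Γ)) :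
    M.Sat ρ (Fml.conj l) ↔ ∀ φ ∈ l, M.Sat ρ φ := by
  induction l with
  | nil => simp [Fml.conj, Struc.Sat]
  | cons φ l ih => rw [List.forall_mem_cons, ← ih]; rfl

/-- Extend an assignment by the values `f 0, …, f (k - 1)` for `k` further element variables. -/
def Assign.pushElems {Γ : List Srt} (f : ℕ → M.dom .elem) (ρ : Assign M Γ) :
    (k : ℕ) → Assign M (elems k Γ)
  | 0 => ρ
  | k + 1 => Assign.push (f k) (Assign.pushElems f ρ k)

theorem Assign.pushElems_shift {Γ : List Srt} (f : ℕ → M.dom .elem) (ρ : Assign M Γ) {s : Srt}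
    (v : Var Γ s) : ∀ k : ℕ, ρ.pushElems f k (shift k v) = ρ v
  | 0 => rfl
  | k + 1 => pushElems_shift f ρ v k

/-- Only this direction is needed: blocks of element quantifiers occur in the premises of the
induction formula and are only ever instantiated. -/
theorem Struc.sat_of_allElems {Γ : List Srt} {ρ : Assign M Γ} (f : ℕ → M.dom .elem) :
    ∀ {k : ℕ} {φ : Fml (elems k Γ)}, M.Sat ρ (allElems k φ) → M.Sat (ρ.pushElems f k) φ
  | 0, _, h => h
  | k + 1, φ, h => (sat_of_allElems f h : M.Sat (ρ.pushElems f k) (.all .elem φ)) (f k)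

theorem Struc.eval_newVars {Γ : List Srt} (f : ℕ → M.dom .elem) (ρ : Assign M Γ) :
    ∀ k : ℕ, (newVars k).map (M.eval (ρ.pushElems f k)) = (List.range k).map f
  | 0 => rfl
  | k + 1 => by
    have h : ((newVars k).map (Term.weaken .elem) ++ [Term.var .zero]).map
        (M.eval (Assign.push (f k) (ρ.pushElems f k))) = (List.range (k + 1)).map f := by
      rw [List.map_append, List.map_map, List.range_succ, List.map_append,
        ← eval_newVars f ρ k]
      congr 1
      exact List.map_congr_left fun t _ => M.eval_weaken _ _ t
    exact h

theorem Struc.eval_consMult {Γ : List Srt} (ρ : Assign M Γ) (ts : List (Term Γ .elem))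
    (t : Term Γ .list) :
    M.eval ρ (consMult ts t) = (ts.map (M.eval ρ)).foldr M.cons (M.eval ρ t) := by
  induction ts with
  | nil => rfl
  | cons t' ts ih => exact congrArg (M.cons _) ih

theorem Struc.sat_of_indBase {Γ : List Srt} {ρ : Assign M Γ} {k : ℕ} {φ : Fml (.list :: Γ)}
    (h : M.Sat ρ (indBase k φ)) (f : ℕ → M.dom .elem) :
    M.Sat (Assign.push (((List.range k).map f).foldr M.cons M.nil : M.dom .list) ρ) φ := by
  have h' := M.sat_of_allElems f h
  rw [M.sat_subst, Assign.comp_push, M.eval_consMult, M.eval_newVars] at h'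
  have e : (ρ.pushElems f k).comp (fun _ v => .var (shift k v)) = ρ := by
    funext s v
    exact Assign.pushElems_shift f ρ v k
  rwa [e] at h'

theorem Struc.sat_of_indStep {Γ : List Srt} {ρ : Assign M Γ} {m : ℕ} {φ : Fml (.list :: Γ)}
    (h : M.Sat ρ (indStep m φ)) (f : ℕ → M.dom .elem) (X : M.dom .list)
    (hX : M.Sat (Assign.push X ρ) φ) :
    M.Sat (Assign.push (((List.range m).map f).foldr M.cons X : M.dom .list) ρ) φ := by
  have h' := M.sat_of_allElems f (h X)
  simp only [Struc.Sat] at h'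
  rw [M.sat_subst, M.sat_subst, Assign.comp_push, M.eval_consMult, M.eval_newVars] at h'
  have e : M.eval ((Assign.push X ρ).pushElems f m) (.var (shift m .zero)) = X :=
    Assign.pushElems_shift f _ .zero m
  rw [e] at h'
  convert h' ?_ using 2
  · funext s v
    exact (Assign.pushElems_shift f (Assign.push X ρ) (.succ v) m).symm
  · convert hX using 1
    funext s v
    exact Assign.pushElems_shift f (Assign.push X ρ) v m

end Semantics

/-! ### The monoid of transfinite sequences -/

namespace TSeq

/-- The entry with index `γ`, if there is one. -/
noncomputable def get (a : TSeq) (γ : Ordinal.{0}) : Option ℕ :=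
  open Classical in if h : γ < a.len then some (a.val ⟨γ, h⟩) else none

theorem get_of_lt {a : TSeq} {γ : Ordinal.{0}} (h : γ < a.len) :
    a.get γ = some (a.val ⟨γ, h⟩) := dif_pos h

theorem get_of_le {a : TSeq} {γ : Ordinal.{0}} (h : a.len ≤ γ) : a.get γ = none :=
  dif_neg h.not_gt

/-- Comparing entries through `get` avoids `val`, whose domain depends on the length. -/
theorem ext_get {a b : TSeq} (hl : a.len = b.len) (h : ∀ γ < a.len, a.get γ = b.get γ) :
    a = b := by
  obtain ⟨l, f⟩ := a
  obtain ⟨l', g⟩ := b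
  obtain rfl : l = l' := hl
  congr 1
  funext ⟨γ, hγ⟩
  have := h γ hγ
  rw [get_of_lt hγ, get_of_lt (a := ⟨l, g⟩) hγ] at this
  exact Option.some.inj this

noncomputable instance : One TSeq := ⟨TSeq.empty⟩

/-- In multiplicative notation words are evaluated by `List.prod`, and `a ∣ b` says that `a` is a
prefix of `b`. -/
noncomputable instance : Mul TSeq := ⟨TSeq.concat⟩

@[simp] theorem len_one : (1 : TSeq).len = 0 := rfl

@[simp] theorem len_mul (a b : TSeq) : (a * b).len = a.len + b.len := rfl

@[simp] theorem len_single (n : ℕ) : (single n).len = 1 := rfl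

theorem get_mul_of_lt (a b : TSeq) {γ : Ordinal.{0}} (h : γ < a.len) :
    (a * b).get γ = a.get γ := by
  rw [get_of_lt (show γ < (a * b).len from h.trans_le (le_self_add)), get_of_lt h]
  exact congrArg some (dif_pos h)

theorem get_mul_add (a b : TSeq) (δ : Ordinal.{0}) : (a * b).get (a.len + δ) = b.get δ := by
  by_cases h : δ < b.len
  · have h' : a.len + δ < (a * b).len := by simpa using h
    rw [get_of_lt h', get_of_lt h]
    refine congrArg some ((dif_neg (not_lt.mpr le_self_add)).trans ?_)
    congr 2
    exact Ordinal.add_sub_cancel _ _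
  · rw [get_of_le (not_lt.mp h), get_of_le]
    simpa using h

theorem get_single_zero (n : ℕ) : (single n).get 0 = some n :=
  get_of_lt (a := single n) zero_lt_one

theorem len_eq_zero {a : TSeq} : a.len = 0 ↔ a = 1 := by
  refine ⟨fun h => ext_get h fun γ hγ => ?_, fun h => h ▸ rfl⟩
  rw [h] at hγ
  exact absurd hγ not_lt_zero

noncomputable instance : Monoid TSeq where
  mul_assoc a b c := by
    refine ext_get (by simp [add_assoc]) fun γ _ => ?_
    rcases lt_or_ge γ a.len with h | h
    · rw [get_mul_of_lt _ _ (h.trans_le le_self_add), get_mul_of_lt _ _ h, get_mul_of_lt _ _ h]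
    obtain ⟨δ, rfl⟩ := exists_add_of_le h
    rcases lt_or_ge δ b.len with h' | h'
    · rw [get_mul_of_lt _ _ (by simpa using h'), get_mul_add, get_mul_add, get_mul_of_lt _ _ h']
    obtain ⟨ε, rfl⟩ := exists_add_of_le h'
    rw [get_mul_add, get_mul_add, ← add_assoc]
    exact get_mul_add (a * b) c ε
  one_mul a := by
    refine ext_get (by simp) fun γ _ => ?_
    have := get_mul_add 1 a γ
    rwa [len_one, zero_add] at this
  mul_one a := ext_get (by simp) fun γ h => get_mul_of_lt _ _ (by simpa using h)

/-- Inherited from left cancellation of ordinal addition. Cancellation on the right fails: putting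
`0` in front of the constant sequence `0` of length `ω` changes nothing. -/
theorem mul_left_cancel' {a b c : TSeq} (h : a * b = a * c) : b = c := by
  have hl : b.len = c.len := by simpa using congrArg len h
  refine ext_get hl fun γ _ => ?_
  rw [← get_mul_add a b, h, get_mul_add]

theorem mul_eq_one {a b : TSeq} : a * b = 1 ↔ a = 1 ∧ b = 1 := by
  rw [← len_eq_zero, ← len_eq_zero, ← len_eq_zero, len_mul,
    Ordinal.add_eq_zero_iff]

theorem single_mul_ne_one (n : ℕ) (a : TSeq) : single n * a ≠ 1 := fun h => by
  simpa using congrArg len (mul_eq_one.mp h).1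

theorem single_mul_inj {n m : ℕ} {a b : TSeq} (h : single n * a = single m * b) :
    n = m ∧ a = b := by
  have h0 := congrArg (get · 0) h
  rw [get_mul_of_lt _ _ (by simp), get_mul_of_lt _ _ (by simp), get_single_zero,
    get_single_zero] at h0
  obtain rfl := Option.some.inj h0
  exact ⟨rfl, mul_left_cancel' h⟩

/-- A sequence that agrees with `a` below its length is a prefix of `a`. -/
theorem dvd_of_get {p a : TSeq} (hl : p.len ≤ a.len) (h : ∀ γ < p.len, p.get γ = a.get γ) :
    p ∣ a := by
  obtain ⟨δ, hδ⟩ := exists_add_of_le hl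
  -- The cofactor is the tail of `a` from position `p.len` on.
  refine ⟨⟨δ, fun i => a.val ⟨p.len + i.1, by rw [hδ]; exact add_lt_add_right (Set.mem_Iio.mp i.2) _⟩⟩, ?_⟩
  refine ext_get hδ fun γ hγ => ?_
  rcases lt_or_ge γ p.len with h' | h'
  · rw [get_mul_of_lt _ _ h', h γ h']
  obtain ⟨ε, rfl⟩ := exists_add_of_le h'
  have hε : ε < δ := by simpa [hδ] using hγ
  rw [get_mul_add, get_of_lt hγ]
  exact (get_of_lt (a := ⟨δ, fun i => _⟩) hε).symm

/-- Two prefixes of a sequence are comparable. -/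
theorem dvd_or_dvd {a b c d : TSeq} (h : a * b = c * d) : a ∣ c ∨ c ∣ a := by
  rcases le_total a.len c.len with hl | hl
  · refine .inl (dvd_of_get hl fun γ hγ => ?_)
    rw [← get_mul_of_lt a b hγ, h, get_mul_of_lt c d (hγ.trans_le hl)]
  · refine .inr (dvd_of_get hl fun γ hγ => ?_)
    rw [← get_mul_of_lt c d hγ, ← h, get_mul_of_lt a b (hγ.trans_le hl)]

theorem eq_one_or_single_mul (a : TSeq) : a = 1 ∨ ∃ n b, a = single n * b := by
  rcases eq_or_ne a.len 0 with h | h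
  · exact .inl (len_eq_zero.mp h)
  have h0 : 0 < a.len := pos_iff_ne_zero.mpr h
  refine .inr ⟨a.val ⟨0, h0⟩, dvd_of_get ?_ fun γ hγ => ?_⟩
  · exact Order.one_le_iff_pos.mpr h0
  · obtain rfl : γ = 0 := Order.lt_one_iff.mp hγ
    rw [get_single_zero, get_of_lt h0]

/-- The sequence with the entries of a finite list. -/
noncomputable def ofList (w : List ℕ) : TSeq := (w.map single).prod

@[simp] theorem ofList_nil : ofList [] = 1 := rfl

theorem ofList_cons (n : ℕ) (w : List ℕ) : ofList (n :: w) = single n * ofList w := by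
  simp [ofList]

theorem ofList_append (w w' : List ℕ) : ofList (w ++ w') = ofList w * ofList w' := by
  simp [ofList]

theorem len_ofList (w : List ℕ) : (ofList w).len = w.length := by
  induction w with
  | nil => simp
  | cons n w ih =>
    rw [ofList_cons, len_mul, ih, len_single, List.length_cons, add_comm w.length]
    push_cast
    rfl

/-! ### Equations in one unknown -/

/-- The value of a word in which `none` stands for the unknown `X`. -/
noncomputable def wordVal (X : TSeq) (w : List (Option TSeq)) : TSeq :=
  (w.map fun o => o.getD X).prod

@[simp] theorem wordVal_nil (X : TSeq) : wordVal X [] = 1 := rfl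

@[simp] theorem wordVal_none_cons (X : TSeq) (w : List (Option TSeq)) :
    wordVal X (none :: w) = X * wordVal X w := by simp [wordVal]

@[simp] theorem wordVal_some_cons (X a : TSeq) (w : List (Option TSeq)) :
    wordVal X (some a :: w) = a * wordVal X w := by simp [wordVal]

/-- `X` is non-empty and its first entry is not in `S`. -/
def Fresh (S : Finset ℕ) (X : TSeq) : Prop := ∃ n ∉ S, ∃ Y, X = single n * Y

theorem Fresh.mono {S S' : Finset ℕ} (h : S ⊆ S') {X : TSeq} (hX : Fresh S' X) : Fresh S X :=
  let ⟨n, hn, Y, hY⟩ := hX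
  ⟨n, fun hn' => hn (h hn'), Y, hY⟩

theorem wordVal_none_cons_ne {w w' : List (Option TSeq)} {n : ℕ} {b : TSeq} :
    ∀ X, Fresh {n} X → wordVal X (none :: w) ≠ wordVal X (some (single n * b) :: w') := by
  rintro X ⟨k, hk, Y, rfl⟩ h
  rw [wordVal_none_cons, wordVal_some_cons, mul_assoc, mul_assoc] at h
  exact hk (by simpa using (single_mul_inj h).1)

/-- The truth value of an equation is the same for all sequences that begin with an entry outside
some finite set. -/
theorem exists_finset_wordVal_eq_iff (l r : List (Option TSeq)) :
    ∃ S : Finset ℕ, ∃ p : Prop, ∀ X, Fresh S X → (wordVal X l = wordVal X r ↔ p) := by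
  match l, r with
  | [], [] => exact ⟨∅, True, by simp⟩
  -- A fresh `X` is non-empty, so no entry has to be excluded here.
  | [], none :: r =>
    refine ⟨∅, False, ?_⟩
    rintro _ ⟨n, -, Y, rfl⟩
    rw [wordVal_none_cons, mul_assoc, wordVal_nil, iff_false]
    exact (single_mul_ne_one _ _).symm
  | none :: l, [] =>
    refine ⟨∅, False, ?_⟩
    rintro _ ⟨n, -, Y, rfl⟩
    rw [wordVal_none_cons, mul_assoc, wordVal_nil, iff_false]
    exact single_mul_ne_one _ _
  | none :: l, none :: r =>
    obtain ⟨S, p, h⟩ := exists_finset_wordVal_eq_iff l r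
    refine ⟨S, p, fun X hX => ?_⟩
    rw [← h X hX, wordVal_none_cons, wordVal_none_cons]
    exact ⟨mul_left_cancel', fun h => by rw [h]⟩
  | some a :: l, [] =>
    rcases eq_one_or_single_mul a with rfl | ⟨n, b, rfl⟩
    · obtain ⟨S, p, h⟩ := exists_finset_wordVal_eq_iff l []
      exact ⟨S, p, fun X hX => by rw [← h X hX, wordVal_some_cons, one_mul]⟩
    · refine ⟨∅, False, fun X _ => ?_⟩
      rw [wordVal_some_cons, mul_assoc, wordVal_nil, iff_false]
      exact single_mul_ne_one _ _
  | [], some a :: r =>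
    rcases eq_one_or_single_mul a with rfl | ⟨n, b, rfl⟩
    · obtain ⟨S, p, h⟩ := exists_finset_wordVal_eq_iff [] r
      exact ⟨S, p, fun X hX => by rw [← h X hX, wordVal_some_cons, one_mul]⟩
    · refine ⟨∅, False, fun X _ => ?_⟩
      rw [wordVal_some_cons, mul_assoc, wordVal_nil, iff_false]
      exact (single_mul_ne_one _ _).symm
  | none :: l, some a :: r =>
    -- An empty constant is dropped. Otherwise its first entry `n` is the one value that the first
    -- entry of `X` has to avoid.
    rcases eq_one_or_single_mul a with rfl | ⟨n, b, rfl⟩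
    · obtain ⟨S, p, h⟩ := exists_finset_wordVal_eq_iff (none :: l) r
      exact ⟨S, p, fun X hX => by rw [← h X hX, wordVal_some_cons, one_mul]⟩
    · exact ⟨{n}, False, fun X hX => iff_false_intro (wordVal_none_cons_ne X hX)⟩
  | some a :: l, none :: r =>
    rcases eq_one_or_single_mul a with rfl | ⟨n, b, rfl⟩
    · obtain ⟨S, p, h⟩ := exists_finset_wordVal_eq_iff l (none :: r)
      exact ⟨S, p, fun X hX => by rw [← h X hX, wordVal_some_cons, one_mul]⟩
    · exact ⟨{n}, False, fun X hX => iff_false_intro (wordVal_none_cons_ne X hX).symm⟩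
  -- If one constant is a prefix of the other, it is cancelled and the remainder kept, which
  -- shortens the two words by one letter in total. If neither is, the sides never agree, since two
  -- prefixes of one sequence are comparable.
  | some a :: l, some c :: r =>
    by_cases hac : a ∣ c
    · obtain ⟨e, rfl⟩ := hac
      obtain ⟨S, p, h⟩ := exists_finset_wordVal_eq_iff l (some e :: r)
      refine ⟨S, p, fun X hX => ?_⟩
      rw [← h X hX, wordVal_some_cons, wordVal_some_cons, wordVal_some_cons, mul_assoc]
      exact ⟨mul_left_cancel', fun h => by rw [h]⟩
    by_cases hca : c ∣ a
    · obtain ⟨e, rfl⟩ := hca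
      obtain ⟨S, p, h⟩ := exists_finset_wordVal_eq_iff (some e :: l) r
      refine ⟨S, p, fun X hX => ?_⟩
      rw [← h X hX, wordVal_some_cons, wordVal_some_cons, wordVal_some_cons, mul_assoc]
      exact ⟨mul_left_cancel', fun h => by rw [h]⟩
    · refine ⟨∅, False, fun X _ => iff_false_intro fun h => ?_⟩
      rw [wordVal_some_cons, wordVal_some_cons] at h
      exact (dvd_or_dvd h).elim hac hca
termination_by l.length + r.length

/-! ### Sequences without infinite repetition at finite positions -/

/-- The sequences in which no number occurs at infinitely many finite positions. -/
def finRep : Set TSeq := {a | ∀ v : ℕ, {n : ℕ | a.get n = some v}.Finite}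

theorem one_mem_finRep : (1 : TSeq) ∈ finRep := fun v => by
  refine Set.finite_empty.subset fun n hn => ?_
  rw [Set.mem_ofPred_eq, get_of_le zero_le] at hn
  simp at hn

/-- If `a` is finite, the finite positions of the product are those of `a` and shifted ones of `b`.
If `a` has length at least `ω`, they all lie in `a`, and `b` plays no role. -/
theorem mul_mem_finRep {a b : TSeq} (ha : a ∈ finRep) (hb : b ∈ finRep) :
    a * b ∈ finRep := by
  intro v
  rcases lt_or_ge a.len Ordinal.omega0 with h | h
  · obtain ⟨L, hL⟩ := Ordinal.lt_omega0.mp h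
    refine ((ha v).union ((hb v).image (L + ·))).subset fun n hn => ?_
    rcases lt_or_ge n L with hnL | hnL
    · left
      rwa [Set.mem_ofPred_eq, get_mul_of_lt _ _ (by rw [hL]; exact_mod_cast hnL)] at hn
    · obtain ⟨k, rfl⟩ := exists_add_of_le hnL
      refine .inr ⟨k, ?_, rfl⟩
      rwa [Set.mem_ofPred_eq, Nat.cast_add, ← hL, get_mul_add] at hn
  · refine (ha v).subset fun n hn => ?_
    rwa [Set.mem_ofPred_eq, get_mul_of_lt _ _ ((Ordinal.natCast_lt_omega0 n).trans_le h)] at hn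

theorem single_mem_finRep (n : ℕ) : single n ∈ finRep := fun v => by
  refine (Set.finite_singleton 0).subset fun k hk => ?_
  by_contra hk0
  rw [Set.mem_ofPred_eq, get_of_le] at hk
  · simp at hk
  · rw [len_single]
    exact_mod_cast Nat.one_le_iff_ne_zero.mpr hk0

theorem ofList_mem_finRep (w : List ℕ) : ofList w ∈ finRep := by
  induction w with
  | nil => exact one_mem_finRep
  | cons n w ih => exact ofList_cons n w ▸ mul_mem_finRep (single_mem_finRep n) ih

theorem get_N₀ (n : ℕ) : N₀.get n = some n := by
  have h : (n : Ordinal.{0}) < N₀.len := Ordinal.natCast_lt_omega0 n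
  rw [get_of_lt h]
  have : (n : Ordinal.{0}) = (N₀.val ⟨n, h⟩ : ℕ) :=
    Classical.choose_spec (Ordinal.lt_omega0.mp h)
  rw [← Nat.cast_injective this]

theorem N₀_mem_finRep : N₀ ∈ finRep := fun v => by
  refine (Set.finite_singleton v).subset fun n hn => ?_
  rw [Set.mem_ofPred_eq, get_N₀] at hn
  exact Option.some.inj hn

theorem isListDomain_finRep : IsListDomain finRep where
  empty_mem := one_mem_finRep
  cons_mem n _ ha := mul_mem_finRep (single_mem_finRep n) ha
  concat_mem _ ha _ hb := mul_mem_finRep ha hb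

/-! ### Finite prefixes and the induction principle -/

theorem get_ofList_mul (w : List ℕ) (X : TSeq) (n : ℕ) :
    (ofList w * X).get (w.length + n : ℕ) = X.get n := by
  rw [Nat.cast_add, ← len_ofList, get_mul_add]

/-- Guarantees that the suffix left after removing a finite prefix is still a list of the model. -/
theorem mem_finRep_of_ofList_mul {w : List ℕ} {X : TSeq} (h : ofList w * X ∈ finRep) :
    X ∈ finRep := fun v => by
  refine ((h v).preimage (add_right_injective w.length).injOn).subset fun n hn => ?_
  rwa [Set.mem_preimage, Set.mem_ofPred_eq, get_ofList_mul]

/-- A sequence that is not a finite list has finite prefixes of all lengths. -/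
theorem exists_eq_ofList_mul {X : TSeq} (hX : ∀ w, X ≠ ofList w) (k : ℕ) :
    ∃ w n Y, w.length = k ∧ X = ofList w * (single n * Y) := by
  induction k with
  | zero =>
    rcases eq_one_or_single_mul X with h | ⟨n, Y, h⟩
    · exact absurd h (hX [])
    · exact ⟨[], n, Y, rfl, by rw [ofList_nil, one_mul, h]⟩
  | succ k ih =>
    obtain ⟨w, n, Y, rfl, h⟩ := ih
    have h' : X = ofList (w ++ [n]) * Y := by
      rw [h, ofList_append, ofList_cons, ofList_nil, mul_one, mul_assoc]
    rcases eq_one_or_single_mul Y with rfl | ⟨n', Y', rfl⟩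
    · exact absurd (h'.trans (mul_one _)) (hX _)
    · exact ⟨w ++ [n], n', Y', by simp, h'⟩

/-- Removing a finite prefix whose length is a suitable multiple of `m` from a sequence in `finRep`
that is not a finite list leaves a sequence whose first entry is not in `S`. -/
theorem exists_fresh_suffix {X : TSeq} (hX : X ∈ finRep) (hX' : ∀ w, X ≠ ofList w) {m : ℕ}
    (hm : 1 ≤ m) (S : Finset ℕ) :
    ∃ w Y, m ∣ w.length ∧ X = ofList w * Y ∧ Fresh S Y := by
  -- `N` bounds the finite positions at which `X` takes a value in `S`; the multiple `m * (N + 1)`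
  -- of `m` lies beyond it.
  obtain ⟨N, hN⟩ := (S.finite_toSet.biUnion fun v _ => hX v).bddAbove
  obtain ⟨w, n, Y, hw, h⟩ := exists_eq_ofList_mul hX' (m * (N + 1))
  refine ⟨w, single n * Y, ⟨_, hw⟩, h, n, fun hn => ?_, Y, rfl⟩
  have hle : w.length ≤ N := by
    refine hN (Set.mem_biUnion hn ?_)
    have := get_ofList_mul w (single n * Y) 0
    rwa [← h, add_zero, Nat.cast_zero, get_mul_of_lt _ _ (by simp), get_single_zero] at this
  nlinarith

/-- The `m`-step induction principle on `finRep`, for a property whose truth value is the same for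
all sequences that begin with an entry outside some finite set. -/
theorem finRep_induction {m : ℕ} (hm : 1 ≤ m) {P : TSeq → Prop} {S : Finset ℕ} {p : Prop}
    (hS : ∀ X ∈ finRep, Fresh S X → (P X ↔ p))
    (base : ∀ w : List ℕ, w.length < m → P (ofList w))
    (step : ∀ w : List ℕ, w.length = m → ∀ X ∈ finRep, P X → P (ofList w * X))
    {X : TSeq} (hX : X ∈ finRep) : P X := by
  have take_drop (w : List ℕ) : ofList w = ofList (w.take m) * ofList (w.drop m) := by
    rw [← ofList_append, List.take_append_drop]
  have fin : ∀ (n : ℕ) (w : List ℕ), w.length = n → P (ofList w) := by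
    intro n
    induction n using Nat.strong_induction_on with
    | _ n ih =>
      intro w hw
      rcases lt_or_ge w.length m with h | h
      · exact base w h
      · rw [take_drop]
        exact step _ (by simpa using h) _ (ofList_mem_finRep _)
          (ih (n - m) (by omega) _ (by simp [hw]))
  have steps (Y : TSeq) (hY : Y ∈ finRep) (hP : P Y) :
      ∀ (k : ℕ) (w : List ℕ), w.length = m * k → P (ofList w * Y) := by
    intro k
    induction k with
    | zero =>
      intro w hw
      obtain rfl : w = [] := by simpa using hw
      simpa using hP
    | succ k ih =>
      intro w hw
      rw [mul_add, mul_one] at hw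
      rw [take_drop, mul_assoc]
      exact step _ (by simp [hw]) _ (mul_mem_finRep (ofList_mem_finRep _) hY)
        (ih _ (by simp [hw]))
  by_cases hl : ∃ w, X = ofList w
  · obtain ⟨w, rfl⟩ := hl
    exact fin _ w rfl
  obtain ⟨w, Y, ⟨k, hk⟩, rfl, hY⟩ := exists_fresh_suffix hX (not_exists.mp hl) hm S
  have hYm := mem_finRep_of_ofList_mul hX
  refine steps Y hYm ((hS Y hYm hY).mpr ?_) k w hk
  -- The one-entry list `[n]` is as fresh as `Y`, and `P` is already known for finite lists, so `p`
  -- holds.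
  obtain ⟨n, hn, -⟩ := hY
  exact (hS _ (ofList_mem_finRep [n]) ⟨n, hn, 1, ofList_cons n []⟩).mp (fin 1 [n] rfl)

end TSeq

/-! ### The model -/

/-- The structure of the sequences in `TSeq.finRep`. -/
noncomputable abbrev finRepStruc : Struc.{1} := seqStruc TSeq.finRep TSeq.isListDomain_finRep

/-- The sequence that is an element of sort `list` of the model. -/
def finRepStruc.toTSeq (X : finRepStruc.dom .list) : TSeq := Subtype.val (p := (· ∈ TSeq.finRep)) X

/-- The number that is an element of sort `elem` of the model. -/
def finRepStruc.toNat (x : finRepStruc.dom .elem) : ℕ := ULift.down (α := ℕ) x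

namespace finRepStruc

/-- A sequence in `TSeq.finRep` as an element of the model. -/
def mk (X : TSeq) (hX : X ∈ TSeq.finRep) : finRepStruc.dom .list :=
  (⟨X, hX⟩ : TSeq.finRep)

/-- A number as an element of the model. -/
def ofNat (n : ℕ) : finRepStruc.dom .elem := (ULift.up n : ULift.{1} ℕ)

theorem toNat_ofNat (n : ℕ) : toNat (ofNat n) = n := rfl

theorem toTSeq_injective : Function.Injective toTSeq := Subtype.val_injective

theorem toNat_injective : Function.Injective toNat := ULift.down_injective

theorem toTSeq_mem (X : finRepStruc.dom .list) : toTSeq X ∈ TSeq.finRep :=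
  Subtype.property (p := (· ∈ TSeq.finRep)) X

@[simp] theorem toTSeq_nil : toTSeq finRepStruc.nil = 1 := rfl

@[simp] theorem toTSeq_cons (x : finRepStruc.dom .elem) (X : finRepStruc.dom .list) :
    toTSeq (finRepStruc.cons x X) = TSeq.single (toNat x) * toTSeq X := rfl

@[simp] theorem toTSeq_app (X Y : finRepStruc.dom .list) :
    toTSeq (finRepStruc.app X Y) = toTSeq X * toTSeq Y := rfl

theorem toTSeq_foldr_cons (l : List (finRepStruc.dom .elem)) (X : finRepStruc.dom .list) :
    toTSeq (l.foldr finRepStruc.cons X) = TSeq.ofList (l.map toNat) * toTSeq X := by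
  induction l with
  | nil => simp
  | cons x l ih =>
    rw [List.foldr_cons, toTSeq_cons, ih, List.map_cons, TSeq.ofList_cons, mul_assoc]

/-- Terms of sort `elem` are variables other than the unknown, as no function symbol yields an
element. So `cons` contributes a constant letter, and by associativity bracketing does not matter.
-/
theorem exists_word {Γ : List Srt} (ρ : Assign finRepStruc Γ) :
    ∀ t : Term (.list :: Γ) .list, ∃ w : List (Option TSeq), ∀ X,
      toTSeq (finRepStruc.eval (Assign.push X ρ) t) = TSeq.wordVal (toTSeq X) w
  | .var .zero => ⟨[none], fun X => by simp [Struc.eval]⟩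
  | .var (.succ v) => ⟨[some (toTSeq (ρ v))], fun X => by simp [Struc.eval]⟩
  | .nil => ⟨[], fun X => by simp [Struc.eval]⟩
  | .cons (.var (.succ v)) t =>
    let ⟨w, hw⟩ := exists_word ρ t
    ⟨some (TSeq.single (toNat (ρ v))) :: w, fun X => by simp [Struc.eval, hw]⟩
  | .app t u =>
    let ⟨w, hw⟩ := exists_word ρ t
    let ⟨w', hw'⟩ := exists_word ρ u
    ⟨w ++ w', fun X => by simp [Struc.eval, hw, hw', TSeq.wordVal]⟩

/-- The truth value of a quantifier-free formula is the same for all sequences that begin with an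
entry outside some finite set. -/
theorem exists_finset_sat_iff {Γ : List Srt} (ρ : Assign finRepStruc Γ) :
    ∀ φ : Fml (.list :: Γ), φ.IsOpen → ∃ S : Finset ℕ, ∃ p : Prop, ∀ X,
      TSeq.Fresh S (toTSeq X) → (finRepStruc.Sat (Assign.push X ρ) φ ↔ p)
  | .top, _ => ⟨∅, True, fun _ _ => Iff.rfl⟩
  | .bot, _ => ⟨∅, False, fun _ _ => Iff.rfl⟩
  -- An equation between elements cannot mention `X`.
  | .eq (s := .elem) (.var (.succ v)) (.var (.succ v')), _ =>
    ⟨∅, ρ v = ρ v', fun _ _ => Iff.rfl⟩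
  | .eq (s := .list) t u, _ => by
    obtain ⟨w, hw⟩ := exists_word ρ t
    obtain ⟨w', hw'⟩ := exists_word ρ u
    obtain ⟨S, p, h⟩ := TSeq.exists_finset_wordVal_eq_iff w w'
    refine ⟨S, p, fun X hX => ?_⟩
    rw [← h _ hX, ← hw, ← hw']
    exact toTSeq_injective.eq_iff.symm
  | .neg φ, h => by
    obtain ⟨S, p, hS⟩ := exists_finset_sat_iff ρ φ h
    exact ⟨S, ¬ p, fun X hX => not_congr (hS X hX)⟩
  | .and φ ψ, h => by
    obtain ⟨S, p, hS⟩ := exists_finset_sat_iff ρ φ h.1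
    obtain ⟨S', p', hS'⟩ := exists_finset_sat_iff ρ ψ h.2
    exact ⟨S ∪ S', p ∧ p', fun X hX => and_congr (hS X (hX.mono Finset.subset_union_left))
      (hS' X (hX.mono Finset.subset_union_right))⟩
  | .or φ ψ, h => by
    obtain ⟨S, p, hS⟩ := exists_finset_sat_iff ρ φ h.1
    obtain ⟨S', p', hS'⟩ := exists_finset_sat_iff ρ ψ h.2
    exact ⟨S ∪ S', p ∨ p', fun X hX => or_congr (hS X (hX.mono Finset.subset_union_left))
      (hS' X (hX.mono Finset.subset_union_right))⟩
  | .imp φ ψ, h => by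
    obtain ⟨S, p, hS⟩ := exists_finset_sat_iff ρ φ h.1
    obtain ⟨S', p', hS'⟩ := exists_finset_sat_iff ρ ψ h.2
    exact ⟨S ∪ S', p → p', fun X hX => imp_congr (hS X (hX.mono Finset.subset_union_left))
      (hS' X (hX.mono Finset.subset_union_right))⟩

/-! ### Verification of the axioms and failure of right decomposition -/

theorem models_T₁ : finRepStruc.Models T₁ := by
  rintro ψ ((rfl | rfl) | (rfl | rfl)) <;> rw [Struc.sat_closure_iff] <;> intro ρ
  · exact fun h => TSeq.single_mul_ne_one _ _ (congrArg toTSeq h).symm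
  · intro h
    have h' := TSeq.single_mul_inj (congrArg toTSeq h)
    exact ⟨toNat_injective h'.1, toTSeq_injective h'.2⟩
  · exact toTSeq_injective (one_mul _)
  · exact toTSeq_injective (mul_assoc _ _ _)

theorem exists_range_map (w : List ℕ) : ∃ f : ℕ → finRepStruc.dom .elem,
    ((List.range w.length).map f).map toNat = w := by
  -- The default `0` is never read, since only indices below `w.length` are used.
  refine ⟨fun i => ofNat (w.getD i 0), ?_⟩
  rw [List.map_map]
  refine List.ext_getElem (by simp) fun i _ h => ?_
  simp only [List.getElem_map, List.getElem_range, Function.comp_apply, toNat_ofNat]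
  exact List.getD_eq_getElem _ _ h

theorem models_openBigStepInd {m : ℕ} (hm : 1 ≤ m) :
    finRepStruc.Models (openBigStepInd m) := by
  rintro _ ⟨Γ, φ, hφ, rfl⟩
  rw [Struc.sat_closure_iff]
  rintro ρ ⟨hbase, hstep⟩ X
  rw [Struc.sat_conj_iff] at hbase
  obtain ⟨S, p, hS⟩ := exists_finset_sat_iff ρ φ hφ
  -- Quantifying over the membership proof turns truth in the model into a predicate on all of
  -- `TSeq`.
  refine TSeq.finRep_induction (P := fun X => ∀ hX : X ∈ TSeq.finRep,
    finRepStruc.Sat (Assign.push (mk X hX) ρ) φ) (S := S) (p := p) hm ?_ ?_ ?_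
    (toTSeq_mem X) (toTSeq_mem X)
  · exact fun X hX hf => ⟨fun h => (hS (mk X hX) hf).mp (h hX), fun h _ => (hS (mk X hX) hf).mpr h⟩
  · intro w hw hX
    obtain ⟨f, hf⟩ := exists_range_map w
    convert Struc.sat_of_indBase (hbase _ (List.mem_map_of_mem (List.mem_range.mpr hw))) f using 2
    apply toTSeq_injective
    rw [toTSeq_foldr_cons, hf, toTSeq_nil, mul_one]
    rfl
  · rintro w rfl X hX hP hX'
    obtain ⟨f, hf⟩ := exists_range_map w
    convert Struc.sat_of_indStep hstep f (mk X hX) (hP hX) using 2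
    apply toTSeq_injective
    rw [toTSeq_foldr_cons, hf]
    rfl

theorem models_T₁OpenBigStep : finRepStruc.Models T₁OpenBigStep := by
  rintro ψ (h | h)
  · exact models_T₁ ψ h
  · simp only [Set.mem_iUnion] at h
    obtain ⟨m, hm, h⟩ := h
    exact models_openBigStepInd hm ψ h

theorem not_sat_rightDecomposition :
    ¬ finRepStruc.Sat (Assign.push (mk TSeq.N₀ TSeq.N₀_mem_finRep) (Assign.empty finRepStruc))
      rightDecomposition := by
  rintro (h | ⟨x, X, h⟩)
  · exact Ordinal.omega0_ne_zero (congrArg (fun X => (toTSeq X).len) h)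
  -- `1 + 0` is the length of `cons(x', nil)`. The equation would make `ω` the successor of an
  -- ordinal below it, hence finite.
  · have hl : Ordinal.omega0 = (toTSeq X).len + (1 + 0) :=
      congrArg (fun X => (toTSeq X).len) h
    rw [add_zero] at hl
    have hlt : (toTSeq X).len < Ordinal.omega0 := by
      rw [hl]
      exact Order.lt_add_one_iff.mpr le_rfl
    obtain ⟨n, hn⟩ := Ordinal.lt_omega0.mp hlt
    rw [hn] at hl
    exact (Ordinal.natCast_lt_omega0 (n + 1)).ne (by rw [hl]; push_cast; rfl)

end finRepStruc

end ListInduction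

theorem mainTheorem4 :
    ¬ ListInduction.Provable ListInduction.T₁OpenBigStep ListInduction.rightDecomposition ∧
    ∃ (D : Set ListInduction.TSeq) (hD : ListInduction.IsListDomain D)
      (hN : ListInduction.TSeq.N₀ ∈ D),
      (ListInduction.seqStruc D hD).Models ListInduction.T₁OpenBigStep ∧
      ¬ (ListInduction.seqStruc D hD).Sat
        (ListInduction.Assign.push (M := ListInduction.seqStruc D hD)
          (r := ListInduction.Srt.list) ⟨ListInduction.TSeq.N₀, hN⟩
          (ListInduction.Assign.empty (ListInduction.seqStruc D hD)))
        ListInduction.rightDecomposition :=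
  -- Soundness is used at the assignment sending the free variable `X` to `N₀`.
  ⟨fun h => ListInduction.finRepStruc.not_sat_rightDecomposition
      (h.sound ListInduction.finRepStruc.models_T₁OpenBigStep _ (by simp)),
    ListInduction.TSeq.finRep, ListInduction.TSeq.isListDomain_finRep,
    ListInduction.TSeq.N₀_mem_finRep, ListInduction.finRepStruc.models_T₁OpenBigStep,
    ListInduction.finRepStruc.not_sat_rightDecomposition⟩
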